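/- Let $\mathbb K$ be a field of characteristic $0$ and $D=\bigoplus_{i\in\mathbb Z}D_i$ a graded vector space over $\mathbb K$. For $\sigma\in S_k$ and homogeneous $a_1,\dots,a_k\in D$ let $\epsilon(\sigma)=\epsilon(\sigma;a_1,\dots,a_k)$ be the Koszul sign, $a_{\sigma(1)}\odot\cdots\odot a_{\sigma(k)}=\epsilon(\sigma)\,a_1\odot\cdots\odot a_k$. *The Lie algebra of $Dend_\infty[1]$-structures.* Let $C_k=\{[1],\dots,[k]\}$. An element $\mu\in\mathrm{Hom}_n(TD\otimes D\otimes TD,D)$ is a family of multilinear maps $\mu_{k,[r]}:D^{\otimes k}\to D$ ($k\ge1$, $[r]\in C_k$) of degree $n$; put $\mu_{k,[r_1]+\cdots+[r_s]}=\sum_j\mu_{k,[r_j]}$. For $\mu$ of degree $m$ and $\eta$ of degree $n$ set $[\mu,\eta]=\mu\circ\eta-(-1)^{mn}\eta\circ\mu$, where $$(\mu\circ\eta)_{N,[r]}(a_1,\dots,a_N)=\sum_{k+l=N+1}\ \sum_{i=1}^{k}(-1)^{n(|a_1|+\cdots+|a_{i-1}|)}\mu_{k,R_0[r]}\big(a_1,\dots,a_{i-1},\eta_{l,R_i[r]}(a_i,\dots,a_{i+l-1}),a_{i+l},\dots,a_N\big)$$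 and, for given $k,l,i$: $R_0[r]=[r]$ and $R_i[r]=[1]+\cdots+[l]$ if $r\le i-1$; $R_0[r]=[i]$ and $R_i[r]=[r-i+1]$ if $i\le r\le i+l-1$; $R_0[r]=[r-l+1]$ and $R_i[r]=[1]+\cdots+[l]$ if $r\ge i+l$. A $Dend_\infty[1]$-algebra structure on $D$ is a Maurer–Cartan element of this graded Lie algebra, i.e. an element $\mu$ of degree $1$ with $[\mu,\mu]=0$. *The Lie algebra of pre-Lie$_\infty[1]$-structures.* An element $f\in\mathrm{Hom}_n(S(D)\otimes D,D)$ is a family of degree $n$ multilinear maps $f_k:D^{\otimes k}\to D$ ($k\ge1$) that are graded symmetric in the first $k-1$ arguments. For $f$ of degree $m$ and $g$ of degree $n$ the Matsushima–Nijenhuis bracket is $[f,g]_{MN}=f\diamond g-(-1)^{mn}g\diamond f$, where $(f\diamond g)_N(v_1,\dots,v_N)$ is the sum over $k+l=N+1$, $k,l\ge 1$, of $$\sum_{\sigma\in S_{(l-1,1,k-2)}}\epsilon(\sigma)\,f_k\big(g_l(v_{\sigma(1)},\dots,v_{\sigma(l)}),v_{\sigma(l+1)},\dots,v_{\sigma(N-1)},v_N\big)$$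 (present only for $k\ge2$) and $$\sum_{\sigma\in S_{(k-1,l-1)}}\epsilon(\sigma)(-1)^{n(|v_{\sigma(1)}|+\cdots+|v_{\sigma(k-1)}|)}f_k\big(v_{\sigma(1)},\dots,v_{\sigma(k-1)},g_l(v_{\sigma(k)},\dots,v_{\sigma(N-1)},v_N)\big),$$ the sums being over shuffles in $S_{N-1}$. A pre-Lie$_\infty[1]$-algebra structure on $D$ is a Maurer–Cartan element of this graded Lie algebra, i.e. an element $\theta$ of degree $1$ with $[\theta,\theta]_{MN}=0$. **Theorem.** (1) If $(D,\{\mu_{k,[r]}\})$ is a $Dend_\infty[1]$-algebra, then $(D,\{\theta_k\}_{k\ge1})$ is a pre-Lie$_\infty[1]$-algebra, where $\theta_k$ is the multilinear map determined on homogeneous elements by $$\theta_k(a_1,\dots,a_k)=\sum_{\sigma\in S_k}\epsilon(\sigma)\,\mu_{k,[\sigma^{-1}(k)]}(a_{\sigma(1)},\dots,a_{\sigma(k)}).$$ (2) More generally, the linear map $\Psi$ that sends a family $\mu=(\mu_{k,[r]})$ to the family $\Psi(\mu)=(\theta_k)_{k\ge 1}$ given by the same formula is a morphism of graded Lie algebras: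 it maps $\mathrm{Hom}_n(TD\otimes D\otimes TD,D)$ into $\mathrm{Hom}_n(S(D)\otimes D,D)$ for every $n$, and $\Psi([\mu,\eta])=[\Psi(\mu),\Psi(\eta)]_{MN}$ for homogeneous $\mu,\eta$. -/

import Mathlib

namespace HomotopyDend

section Insertion

variable {V : Type*}

/-- Arguments of the outer map of an insertion: for `a = (a_0, …, a_N)`, `N = p + q`, the list
`(a_0, …, a_{i-1}, g(a_i, …, a_{i+q}), a_{i+q+1}, …, a_N)` of length `p + 1`. -/
def insertArgs {p q N : ℕ} (h : p + q = N) (i : Fin (p + 1))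
    (g : (Fin (q + 1) → V) → V) (a : Fin (N + 1) → V) (j : Fin (p + 1)) : V :=
  if j < i then a ⟨j, by omega⟩
  else if j = i then g (fun s => a ⟨i + s, by omega⟩)
  else a ⟨j + q, by omega⟩

/-- Changing one entry of `a` changes one entry of `insertArgs h i g a`. -/
theorem insertArgs_update {p q N : ℕ} (h : p + q = N) (i : Fin (p + 1))
    (g : (Fin (q + 1) → V) → V) (a : Fin (N + 1) → V) (t : Fin (N + 1)) :
    (∃ j : Fin (p + 1), ∀ x : V, insertArgs h i g (Function.update a t x) =
      Function.update (insertArgs h i g a) j x) ∨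
    (∃ s : Fin (q + 1), ∀ x : V, insertArgs h i g (Function.update a t x) =
      Function.update (insertArgs h i g a) i
        (g (Function.update (fun s : Fin (q + 1) => a ⟨i + s, by omega⟩) s x))) := by
  by_cases h₁ : (t : ℕ) < i
  · refine Or.inl ⟨⟨t, by omega⟩, fun x => funext fun j => ?_⟩
    have hg : ∀ s : Fin (q + 1), (⟨i + s, by omega⟩ : Fin (N + 1)) ≠ t := by
      intro s hs
      have := congrArg Fin.val hs
      simp only at this
      omega
    simp only [insertArgs, Function.update_apply, hg, if_false, Fin.ext_iff, Fin.lt_def]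
    split_ifs <;> first | rfl | omega
  · by_cases h₂ : (t : ℕ) ≤ i + q
    · refine Or.inr ⟨⟨t - i, by omega⟩, fun x => funext fun j => ?_⟩
      have hg : (fun s : Fin (q + 1) => Function.update a t x ⟨i + s, by omega⟩) =
          Function.update (fun s : Fin (q + 1) => a ⟨i + s, by omega⟩) ⟨t - i, by omega⟩ x := by
        funext s
        simp only [Function.update_apply, Fin.ext_iff]
        split_ifs <;> first | rfl | omega
      by_cases hj : j = i
      · subst hj
        simp only [insertArgs, lt_irrefl, if_false, if_true, Function.update_self, hg]
      · rw [Function.update_of_ne hj]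
        simp only [insertArgs, Function.update_apply, Fin.ext_iff, Fin.lt_def]
        rw [Fin.ext_iff] at hj
        split_ifs <;> first | rfl | omega
    · refine Or.inl ⟨⟨t - q, by omega⟩, fun x => funext fun j => ?_⟩
      have hg : ∀ s : Fin (q + 1), (⟨i + s, by omega⟩ : Fin (N + 1)) ≠ t := by
        intro s hs
        have := congrArg Fin.val hs
        simp only at this
        omega
      simp only [insertArgs, Function.update_apply, hg, if_false, Fin.ext_iff, Fin.lt_def]
      split_ifs <;> first | rfl | omega

end Insertion

section Multilinear

variable {K V : Type*} [Field K] [AddCommGroup V] [Module K V]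

/-- The partial composition (insertion) of `g` into the `i`-th slot of `f`:
`(a_0, …, a_N) ↦ f(a_0, …, a_{i-1}, g(a_i, …, a_{i+q}), a_{i+q+1}, …, a_N)`. No sign. -/
def insertAt {p q N : ℕ} (h : p + q = N) (i : Fin (p + 1))
    (f : MultilinearMap K (fun _ : Fin (p + 1) => V) V)
    (g : MultilinearMap K (fun _ : Fin (q + 1) => V) V) :
    MultilinearMap K (fun _ : Fin (N + 1) => V) V where
  toFun a := f (insertArgs h i g a)
  map_update_add' := by
    intro inst a t x y
    rw [Subsingleton.elim inst (instDecidableEqFin (N + 1))]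
    rcases insertArgs_update h i g a t with ⟨j, hj⟩ | ⟨s, hs⟩
    · rw [hj, hj, hj, f.map_update_add]
    · rw [hs, hs, hs, g.map_update_add, f.map_update_add]
  map_update_smul' := by
    intro inst a t c x
    rw [Subsingleton.elim inst (instDecidableEqFin (N + 1))]
    rcases insertArgs_update h i g a t with ⟨j, hj⟩ | ⟨s, hs⟩
    · rw [hj, hj, f.map_update_smul]
    · rw [hs, hs, g.map_update_smul, f.map_update_smul]

end Multilinear

/-- The Koszul sign `ε(σ; v_1, …, v_k)` for homogeneous elements `v_i` of degree `d i`, i.e. the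
sign with `v_{σ(1)} ⋯ v_{σ(k)} = ε(σ) v_1 ⋯ v_k` in the graded symmetric algebra: one factor
`(-1)^{|v_{σ(i)}| |v_{σ(j)}|}` for every inversion `i < j`, `σ(j) < σ(i)`. -/
def koszulSign {k : ℕ} (σ : Equiv.Perm (Fin k)) (d : Fin k → ℤ) : ℤˣ :=
  ∏ i : Fin k, ∏ j : Fin k,
    if i < j ∧ σ j < σ i then Int.negOnePow (d (σ i) * d (σ j)) else 1

/-- The set `C_{k+1}` is modelled by `Fin (k + 1)` (0-based). This is the map
`R_0(p+1; 1, …, q+1, …, 1) : C_{p+q+1} → C_{p+1}` with `q + 1` in the `i`-th place. -/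
def R₀ {p q N : ℕ} (h : p + q = N) (i : Fin (p + 1)) (r : Fin (N + 1)) : Fin (p + 1) :=
  if h₁ : (r : ℕ) < i then ⟨r, by omega⟩
  else if h₂ : (r : ℕ) ≤ i + q then i
  else ⟨r - q, by omega⟩

/-- The map `R_i(p+1; 1, …, q+1, …, 1) : C_{p+q+1} → 𝕂[C_{q+1}]`. All its values are sums of
distinct basis elements, and such a sum is recorded by the finite set of its terms. -/
def Rᵢ {p q N : ℕ} (_h : p + q = N) (i : Fin (p + 1)) (r : Fin (N + 1)) :
    Finset (Fin (q + 1)) :=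
  if _h₁ : (r : ℕ) < i then Finset.univ
  else if h₂ : (r : ℕ) ≤ i + q then {⟨r - i, by omega⟩}
  else Finset.univ

/-- `(q, 1, N - q - 1)`-shuffles of the first `N` elements of `{0, …, N}`, as permutations of
`{0, …, N}` that fix the last element. -/
def IsShuffleOne {N : ℕ} (q : ℕ) (σ : Equiv.Perm (Fin (N + 1))) : Prop :=
  σ (Fin.last N) = Fin.last N ∧
    ∀ i j : Fin (N + 1), i < j → ((j : ℕ) < q ∨ (q < (i : ℕ) ∧ (j : ℕ) < N)) → σ i < σ j

/-- `(p, N - p)`-shuffles of the first `N` elements of `{0, …, N}`, as permutations of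
`{0, …, N}` that fix the last element. -/
def IsShuffle {N : ℕ} (p : ℕ) (σ : Equiv.Perm (Fin (N + 1))) : Prop :=
  σ (Fin.last N) = Fin.last N ∧
    ∀ i j : Fin (N + 1), i < j → ((j : ℕ) < p ∨ (p ≤ (i : ℕ) ∧ (j : ℕ) < N)) → σ i < σ j

/-- Families `θ = (θ_{k+1})_{k ≥ 0}` of multilinear maps `θ_{k+1} : V^{⊗(k+1)} → V`. -/
abbrev PreLieFamily (K V : Type*) [Field K] [AddCommGroup V] [Module K V] :=
  (k : ℕ) → MultilinearMap K (fun _ : Fin (k + 1) => V) V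

/-- Linear maps `μ : TV ⊗ V ⊗ TV → V`, as families `μ = (μ_{k+1,[r]})_{k ≥ 0, [r] ∈ C_{k+1}}` of
multilinear maps `V^{⊗(k+1)} → V`:
`μ_{k+1,[r]}(a_1, …, a_{k+1}) = μ(a_1 ⋯ a_{r-1} ⊗ a_r ⊗ a_{r+1} ⋯ a_{k+1})`. -/
abbrev DendFamily (K V : Type*) [Field K] [AddCommGroup V] [Module K V] :=
  (k : ℕ) → Fin (k + 1) → MultilinearMap K (fun _ : Fin (k + 1) => V) V

section Graded

variable {K V : Type*} [Field K] [AddCommGroup V] [Module K V]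
variable (𝒱 : ℤ → Submodule K V)

/-- `f` is homogeneous of degree `n`: `|f(a_1, …, a_k)| = |a_1| + ⋯ + |a_k| + n`. -/
def IsHomogeneousOfDegree {k : ℕ} (n : ℤ) (f : MultilinearMap K (fun _ : Fin k => V) V) : Prop :=
  ∀ (d : Fin k → ℤ) (a : Fin k → V), (∀ i, a i ∈ 𝒱 (d i)) → f a ∈ 𝒱 ((∑ i, d i) + n)

/-- `f(a_1, …, a_k, b)` is graded symmetric in `a_1, …, a_k`. -/
def IsGradedSymm {k : ℕ} (f : MultilinearMap K (fun _ : Fin (k + 1) => V) V) : Prop :=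
  ∀ (d : Fin (k + 1) → ℤ) (a : Fin (k + 1) → V), (∀ i, a i ∈ 𝒱 (d i)) →
    ∀ σ : Equiv.Perm (Fin (k + 1)), σ (Fin.last k) = Fin.last k →
      f (fun i => a (σ i)) = koszulSign σ d • f a

/-- `Hom_n(TV ⊗ V ⊗ TV, V)`. -/
def DendHom (n : ℤ) : Submodule K (DendFamily K V) where
  carrier := {μ | ∀ k r, IsHomogeneousOfDegree 𝒱 n (μ k r)}
  add_mem' := fun h₁ h₂ k r d a ha => Submodule.add_mem _ (h₁ k r d a ha) (h₂ k r d a ha)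
  zero_mem' := fun _ _ _ _ _ => Submodule.zero_mem _
  smul_mem' := fun c _ h k r d a ha => Submodule.smul_mem _ c (h k r d a ha)

/-- `Hom_n(S(V) ⊗ V, V)`: families of degree `n` maps `θ_k(a_1, …, a_k)`, `k ≥ 1`, that are graded
symmetric in `a_1, …, a_{k-1}`. -/
def PreLieHom (n : ℤ) : Submodule K (PreLieFamily K V) where
  carrier := {θ | ∀ k, IsHomogeneousOfDegree 𝒱 n (θ k) ∧ IsGradedSymm 𝒱 (θ k)}
  add_mem' := fun {θ η} h₁ h₂ k =>
    ⟨fun d a ha => Submodule.add_mem _ ((h₁ k).1 d a ha) ((h₂ k).1 d a ha),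
     fun d a ha σ hσ => by
      change θ k _ + η k _ = koszulSign σ d • (θ k a + η k a)
      rw [(h₁ k).2 d a ha σ hσ, (h₂ k).2 d a ha σ hσ, smul_add]⟩
  zero_mem' := fun k =>
    ⟨fun _ _ _ => Submodule.zero_mem _, fun d a _ σ _ => by
      change (0 : V) = koszulSign σ d • (0 : V)
      rw [smul_zero]⟩
  smul_mem' := fun c θ h k =>
    ⟨fun d a ha => Submodule.smul_mem _ c ((h k).1 d a ha), fun d a ha σ hσ => by
      change c • θ k _ = koszulSign σ d • (c • θ k a)
      rw [(h k).2 d a ha σ hσ, smul_comm]⟩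

variable [DirectSum.Decomposition 𝒱]

/-- The unique multilinear map that is given by `F d` on homogeneous arguments of degrees
`d = (d_1, …, d_k)`. It serves to define multilinear maps by formulas with Koszul signs. -/
noncomputable def ofHomogeneous {k : ℕ}
    (F : (Fin k → ℤ) → MultilinearMap K (fun _ : Fin k => V) V) :
    MultilinearMap K (fun _ : Fin k => V) V :=
  (MultilinearMap.fromDirectSumEquiv (R := K) (M := fun (_ : Fin k) (j : ℤ) => 𝒱 j)
    (fun d : Fin k → ℤ => (F d).compLinearMap (fun i => (𝒱 (d i)).subtype))).compLinearMap
    (fun _ => (DirectSum.decomposeLinearEquiv 𝒱).toLinearMap)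

theorem ofHomogeneous_apply {k : ℕ}
    (F : (Fin k → ℤ) → MultilinearMap K (fun _ : Fin k => V) V)
    (d : Fin k → ℤ) (a : Fin k → V) (ha : ∀ i, a i ∈ 𝒱 (d i)) :
    ofHomogeneous 𝒱 F a = F d a := by
  have key : ∀ i, DirectSum.decomposeLinearEquiv 𝒱 (a i) =
      DirectSum.lof K ℤ (fun j => 𝒱 j) (d i) ⟨a i, ha i⟩ := by
    intro i
    rw [DirectSum.decomposeLinearEquiv_apply, DirectSum.decompose_of_mem 𝒱 (ha i)]
    rfl
  simp only [ofHomogeneous, MultilinearMap.compLinearMap_apply, LinearEquiv.coe_coe, key]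
  rw [MultilinearMap.fromDirectSumEquiv_lof (p := d)]
  rfl

/-- Multilinear maps that agree on homogeneous elements are equal. -/
theorem ext_homogeneous {k : ℕ} {f g : MultilinearMap K (fun _ : Fin k => V) V}
    (h : ∀ (d : Fin k → ℤ) (a : Fin k → V), (∀ i, a i ∈ 𝒱 (d i)) → f a = g a) : f = g := by
  classical
  have key : f.compLinearMap (fun _ => (DirectSum.decomposeLinearEquiv 𝒱).symm.toLinearMap) =
      g.compLinearMap (fun _ => (DirectSum.decomposeLinearEquiv 𝒱).symm.toLinearMap) := by
    refine MultilinearMap.directSum_ext fun d => ?_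
    ext x
    refine h d _ fun i => ?_
    change (DirectSum.decomposeLinearEquiv 𝒱).symm
      (DirectSum.lof K ℤ (fun j => 𝒱 j) (d i) (x i)) ∈ 𝒱 (d i)
    have : (DirectSum.decomposeLinearEquiv 𝒱).symm
      (DirectSum.lof K ℤ (fun j => 𝒱 j) (d i) (x i)) = x i :=
      DirectSum.decompose_symm_of 𝒱 (x i)
    rw [this]
    exact (x i).2
  ext a
  have := congrArg (fun F => F fun i => DirectSum.decomposeLinearEquiv 𝒱 (a i)) key
  simpa using this

/-- The product `μ ∘ η` on `⨁_n Hom_n(TV ⊗ V ⊗ TV, V)` for `η` of degree `n`: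
`(μ ∘ η)_{[r]}(a_1, …, a_{k+l-1}) = ∑_i (-1)^{n(|a_1| + ⋯ + |a_{i-1}|)}
μ_{k, R_0[r]}(a_1, …, a_{i-1}, η_{l, R_i[r]}(a_i, …, a_{i+l-1}), …, a_{k+l-1})`,
summed over all `k = p + 1`, `l = q + 1` with `p + q = N` in arity `N + 1`. -/
noncomputable def dendComp (n : ℤ) (μ η : DendFamily K V) : DendFamily K V := fun N r =>
  ofHomogeneous 𝒱 fun d =>
    ∑ x ∈ (Finset.HasAntidiagonal.antidiagonal N).attach, ∑ i : Fin (x.1.1 + 1),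
      Int.negOnePow (n * ∑ s ∈ Finset.univ.filter (fun s : Fin (N + 1) => (s : ℕ) < i), d s) •
        insertAt (Finset.HasAntidiagonal.mem_antidiagonal.mp x.2) i
          (μ x.1.1 (R₀ (Finset.HasAntidiagonal.mem_antidiagonal.mp x.2) i r))
          (∑ t ∈ Rᵢ (Finset.HasAntidiagonal.mem_antidiagonal.mp x.2) i r, η x.1.2 t)

/-- The graded Lie bracket `[μ, η] = μ ∘ η - (-1)^{mn} η ∘ μ` on `⨁_n Hom_n(TV ⊗ V ⊗ TV, V)`,
for `μ` of degree `m` and `η` of degree `n`. -/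
noncomputable def dendBracket (m n : ℤ) (μ η : DendFamily K V) : DendFamily K V :=
  dendComp 𝒱 n μ η - Int.negOnePow (m * n) • dendComp 𝒱 m η μ

/-- `(V, μ)` is a `Dend_∞[1]`-algebra: `μ` is a Maurer-Cartan element (degree `1` and
`[μ, μ] = 0`) of the graded Lie algebra `⨁_n Hom_n(TV ⊗ V ⊗ TV, V)`. -/
def IsDendInfty (μ : DendFamily K V) : Prop :=
  μ ∈ DendHom 𝒱 1 ∧ dendBracket 𝒱 1 1 μ μ = 0

open Classical in
/-- The pre-Lie type product `f ⋄ g` that underlies the Matsushima-Nijenhuis bracket on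
`⨁_n Hom_n(S(V) ⊗ V, V)`, for `g` of degree `n`. For `f` of arity `p + 1`, `g` of arity `q + 1` and
`N = p + q`, its value on `(v_1, …, v_{N+1})` is
`∑_{σ ∈ S(q, 1, p-1)} ε(σ) f(g(v_{σ(1)}, …, v_{σ(q+1)}), v_{σ(q+2)}, …, v_{σ(N)}, v_{N+1})`
(only if `p ≥ 1`) plus
`∑_{σ ∈ S(p, q)} ε(σ) (-1)^{n(|v_{σ(1)}| + ⋯ + |v_{σ(p)}|)}
f(v_{σ(1)}, …, v_{σ(p)}, g(v_{σ(p+1)}, …, v_{σ(N)}, v_{N+1}))`. -/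
noncomputable def mnComp (n : ℤ) (f g : PreLieFamily K V) : PreLieFamily K V := fun N =>
  ofHomogeneous 𝒱 fun d =>
    ∑ x ∈ (Finset.HasAntidiagonal.antidiagonal N).attach,
      ((if 1 ≤ x.1.1 then
          ∑ σ : Equiv.Perm (Fin (N + 1)) with IsShuffleOne x.1.2 σ,
            koszulSign σ d •
              (insertAt (Finset.HasAntidiagonal.mem_antidiagonal.mp x.2) 0 (f x.1.1) (g x.1.2)).domDomCongr σ
        else 0) +
        ∑ σ : Equiv.Perm (Fin (N + 1)) with IsShuffle x.1.1 σ,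
          (koszulSign σ d * Int.negOnePow
              (n * ∑ s ∈ Finset.univ.filter (fun s : Fin (N + 1) => (s : ℕ) < x.1.1), d (σ s))) •
            (insertAt (Finset.HasAntidiagonal.mem_antidiagonal.mp x.2) (Fin.last x.1.1)
              (f x.1.1) (g x.1.2)).domDomCongr σ)

/-- The Matsushima-Nijenhuis bracket `[f, g]_MN = f ⋄ g - (-1)^{mn} g ⋄ f`, for `f` of degree `m`
and `g` of degree `n`. -/
noncomputable def mnBracket (m n : ℤ) (f g : PreLieFamily K V) : PreLieFamily K V :=
  mnComp 𝒱 n f g - Int.negOnePow (m * n) • mnComp 𝒱 m g f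

/-- `(V, θ)` is a `pre-Lie_∞[1]`-algebra: `θ` is a Maurer-Cartan element (degree `1` and
`[θ, θ]_MN = 0`) of the graded Lie algebra `⨁_n Hom_n(S(V) ⊗ V, V)`. -/
def IsPreLieInfty (θ : PreLieFamily K V) : Prop :=
  θ ∈ PreLieHom 𝒱 1 ∧ mnBracket 𝒱 1 1 θ θ = 0

/-- The symmetrization map
`Ψ(μ)_k(a_1, …, a_k) = ∑_{σ ∈ S_k} ε(σ) μ_{k, [σ⁻¹(k)]}(a_{σ(1)}, …, a_{σ(k)})`. -/
noncomputable def symmetrization : DendFamily K V →ₗ[K] PreLieFamily K V where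
  toFun μ := fun k => ofHomogeneous 𝒱 fun d =>
    ∑ σ : Equiv.Perm (Fin (k + 1)),
      koszulSign σ d • (μ k (σ.symm (Fin.last k))).domDomCongr σ
  map_add' μ η := by
    funext k
    refine ext_homogeneous 𝒱 fun d a ha => ?_
    simp only [Pi.add_apply, add_apply]
    simp only [ofHomogeneous_apply 𝒱 _ d a ha, sum_apply,
      smul_apply, MultilinearMap.domDomCongr_apply, add_apply,
      smul_add, Finset.sum_add_distrib]
  map_smul' c μ := by
    funext k
    refine ext_homogeneous 𝒱 fun d a ha => ?_
    simp only [Pi.smul_apply, smul_apply, RingHom.id_apply]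
    simp only [ofHomogeneous_apply 𝒱 _ d a ha, sum_apply,
      smul_apply, MultilinearMap.domDomCongr_apply, Finset.smul_sum]
    exact Finset.sum_congr rfl fun σ _ => smul_comm _ _ _

end Graded

end HomotopyDend

/-! The stronger fact proved is that symmetrization respects the pre-Lie type products, Ψ(μ ∘ η) =
Ψ(μ) ⋄ Ψ(η); the statement on brackets and on Maurer–Cartan elements follows by linearity.

Fix arities p + 1 and q + 1. Both sides are sums of the same terms `insertTerm`, indexed by an
insertion slot i, an inner colour t and an order σ of all the arguments. In Ψ(μ ∘ η) the pair (σ, i)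
admits every t if the distinguished last argument lies outside the block fed to η, and only the t at
its position if it lies inside. In Ψ(μ) ⋄ Ψ(η) one has a shuffle s, an outer permutation, given by i
and a permutation τ of the other slots, and an inner one, given by t and ρ. For fixed i and t the
data (s, τ, ρ) correspond bijectively to σ (`blockShuffle_bijective`): sort the arguments outside
the block, and those inside it except the one at t. The two shuffle sums of ⋄ are then the two
cases: last argument inside the block (`sum_isShuffle`) or outside (`sum_isShuffleOne`).

The signs agree by the cocycle identity `koszulSign_mul` and by `koszulSign_insertPerm`, where the
degree n of η carried past the outer arguments is absorbed by the two prefix signs. The colours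
agree by `R₀_insertPerm_symm`. -/

namespace HomotopyDend

/-! ### Positions outside and inside the block of an insertion. -/

section Combinatorics

variable {p q N : ℕ}

/-- The positions of `Fin (N + 1)`, `N = p + q`, split into those outside and those inside the
block `{i, …, i + q}`. -/
def blockFun (h : p + q = N) (i : Fin (p + 1)) : Fin p ⊕ Fin (q + 1) → Fin (N + 1)
  | .inl j => if (j : ℕ) < i then ⟨j, by omega⟩ else ⟨j + 1 + q, by omega⟩
  | .inr s => ⟨i + s, by omega⟩

theorem blockFun_bijective (h : p + q = N) (i : Fin (p + 1)) :
    Function.Bijective (blockFun h i) := by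
  rw [Fintype.bijective_iff_injective_and_card]
  refine ⟨?_, by simp; omega⟩
  rintro (j | s) (j' | s') <;> simp only [blockFun] <;> intro hh <;>
    (try split_ifs at hh) <;> simp only [Fin.ext_iff] at hh <;>
    first | omega | (congr 1; omega)

/-- `blockFun` as an equivalence. -/
noncomputable def blockEquiv (h : p + q = N) (i : Fin (p + 1)) :
    Fin p ⊕ Fin (q + 1) ≃ Fin (N + 1) :=
  Equiv.ofBijective _ (blockFun_bijective h i)

theorem blockEquiv_inl_val (h : p + q = N) (i : Fin (p + 1)) (j : Fin p) :
    (blockEquiv h i (.inl j) : ℕ) = if (j : ℕ) < i then (j : ℕ) else j + 1 + q := by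
  simp only [blockEquiv, Equiv.ofBijective_apply, blockFun]
  split_ifs <;> rfl

theorem blockEquiv_inr_val (h : p + q = N) (i : Fin (p + 1)) (s : Fin (q + 1)) :
    (blockEquiv h i (.inr s) : ℕ) = i + s := rfl

theorem val_succAbove (i : Fin (p + 1)) (j : Fin p) :
    (i.succAbove j : ℕ) = if (j : ℕ) < i then (j : ℕ) else j + 1 := by
  simp only [Fin.succAbove, Fin.lt_def, Fin.val_castSucc]
  split_ifs <;> rfl

theorem blockEquiv_inl_lt_inl (h : p + q = N) (i : Fin (p + 1)) (j j' : Fin p) :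
    blockEquiv h i (.inl j) < blockEquiv h i (.inl j') ↔ j < j' := by
  rw [Fin.lt_def, blockEquiv_inl_val, blockEquiv_inl_val, Fin.lt_def]
  split_ifs <;> omega

theorem blockEquiv_inl_lt_inr (h : p + q = N) (i : Fin (p + 1)) (j : Fin p) (s : Fin (q + 1)) :
    blockEquiv h i (.inl j) < blockEquiv h i (.inr s) ↔ i.succAbove j < i := by
  rw [Fin.lt_def, blockEquiv_inl_val, blockEquiv_inr_val, Fin.lt_def, val_succAbove]
  split_ifs <;> omega

theorem blockEquiv_inr_lt_inl (h : p + q = N) (i : Fin (p + 1)) (j : Fin p) (s : Fin (q + 1)) :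
    blockEquiv h i (.inr s) < blockEquiv h i (.inl j) ↔ i < i.succAbove j := by
  rw [Fin.lt_def, blockEquiv_inl_val, blockEquiv_inr_val, Fin.lt_def, val_succAbove]
  split_ifs <;> omega

theorem blockEquiv_inr_lt_inr (h : p + q = N) (i : Fin (p + 1)) (s s' : Fin (q + 1)) :
    blockEquiv h i (.inr s) < blockEquiv h i (.inr s') ↔ s < s' := by
  rw [Fin.lt_def, blockEquiv_inr_val, blockEquiv_inr_val, Fin.lt_def]
  omega

theorem insertArgs_self {V : Type*} (h : p + q = N) (i : Fin (p + 1))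
    (g : (Fin (q + 1) → V) → V) (a : Fin (N + 1) → V) :
    insertArgs h i g a i = g (fun s => a (blockEquiv h i (.inr s))) := by
  simp only [insertArgs, lt_irrefl, if_false, if_true]
  rfl

theorem insertArgs_succAbove {V : Type*} (h : p + q = N) (i : Fin (p + 1))
    (g : (Fin (q + 1) → V) → V) (a : Fin (N + 1) → V) (j : Fin p) :
    insertArgs h i g a (i.succAbove j) = a (blockEquiv h i (.inl j)) := by
  have hv := val_succAbove i j
  have hb := blockEquiv_inl_val h i j
  simp only [insertArgs, Fin.succAbove_ne, if_false, Fin.lt_def]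
  split_ifs at * <;> first | omega | (congr 1; ext; simp only; omega)

theorem R₀_inl (h : p + q = N) (i : Fin (p + 1)) (j : Fin p) :
    R₀ h i (blockEquiv h i (.inl j)) = i.succAbove j := by
  have hv := val_succAbove i j
  have hb := blockEquiv_inl_val h i j
  ext
  simp only [R₀]
  split_ifs at * <;> first | omega | (simp only []; omega)

theorem R₀_inr (h : p + q = N) (i : Fin (p + 1)) (s : Fin (q + 1)) :
    R₀ h i (blockEquiv h i (.inr s)) = i := by
  have hb := blockEquiv_inr_val h i s
  ext
  simp only [R₀]
  split_ifs <;> simp only <;> omega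

theorem Rᵢ_inl (h : p + q = N) (i : Fin (p + 1)) (j : Fin p) :
    Rᵢ h i (blockEquiv h i (.inl j)) = Finset.univ := by
  have hb := blockEquiv_inl_val h i j
  simp only [Rᵢ]
  split_ifs at * <;> first | rfl | omega

theorem Rᵢ_inr (h : p + q = N) (i : Fin (p + 1)) (s : Fin (q + 1)) :
    Rᵢ h i (blockEquiv h i (.inr s)) = {s} := by
  have hb := blockEquiv_inr_val h i s
  simp only [Rᵢ]
  split_ifs
  · omega
  · congr 1
    ext
    simp only
    omega
  · omega

/-! ### Permutations compatible with a distinguished slot or block. -/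

/-- The permutation that sends `i` to `c` and permutes the other elements by `τ`. -/
def extPerm (c i : Fin (p + 1)) (τ : Equiv.Perm (Fin p)) : Equiv.Perm (Fin (p + 1)) :=
  ((finSuccEquiv' i).trans (Equiv.optionCongr τ)).trans (finSuccEquiv' c).symm

@[simp]
theorem extPerm_self (c i : Fin (p + 1)) (τ : Equiv.Perm (Fin p)) : extPerm c i τ i = c := by
  simp [extPerm]

@[simp]
theorem extPerm_succAbove (c i : Fin (p + 1)) (τ : Equiv.Perm (Fin p)) (j : Fin p) :
    extPerm c i τ (i.succAbove j) = c.succAbove (τ j) := by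
  simp [extPerm]

@[simp]
theorem extPerm_symm_self (c i : Fin (p + 1)) (τ : Equiv.Perm (Fin p)) :
    (extPerm c i τ).symm c = i := by
  rw [Equiv.symm_apply_eq, extPerm_self]

@[simp]
theorem extPerm_symm_succAbove (c i : Fin (p + 1)) (τ : Equiv.Perm (Fin p)) (j : Fin p) :
    (extPerm c i τ).symm (c.succAbove j) = i.succAbove (τ.symm j) := by
  rw [Equiv.symm_apply_eq, extPerm_succAbove, Equiv.apply_symm_apply]

theorem extPerm_bijective (c : Fin (p + 1)) :
    Function.Bijective fun x : Fin (p + 1) × Equiv.Perm (Fin p) => extPerm c x.1 x.2 := by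
  rw [Fintype.bijective_iff_injective_and_card]
  refine ⟨?_, by simp [Fintype.card_perm, Nat.factorial_succ]⟩
  rintro ⟨i, τ⟩ ⟨i', τ'⟩ hh
  simp only at hh
  have hi : i = i' := by
    rw [← extPerm_symm_self c i τ, hh, extPerm_symm_self]
  subst hi
  refine Prod.ext rfl (Equiv.ext fun j => ?_)
  have := congrArg (fun e => e (i.succAbove j)) hh
  simpa using this

theorem sum_perm_eq_sum_extPerm {M : Type*} [AddCommMonoid M] (c : Fin (p + 1))
    (G : Equiv.Perm (Fin (p + 1)) → M) :
    ∑ τ, G τ = ∑ i, ∑ τ, G (extPerm c i τ) := by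
  rw [← (extPerm_bijective c).sum_comp G, Fintype.sum_prod_type]

/-- The permutation that moves the block at `i` to the block at `c`, acting on the block by `ρ`
and on its complement by `τ`. -/
noncomputable def insertPerm (h : p + q = N) (c i : Fin (p + 1)) (τ : Equiv.Perm (Fin p))
    (ρ : Equiv.Perm (Fin (q + 1))) : Equiv.Perm (Fin (N + 1)) :=
  ((blockEquiv h i).symm.trans (Equiv.sumCongr τ ρ)).trans (blockEquiv h c)

@[simp]
theorem insertPerm_inl (h : p + q = N) (c i : Fin (p + 1)) (τ : Equiv.Perm (Fin p))
    (ρ : Equiv.Perm (Fin (q + 1))) (j : Fin p) :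
    insertPerm h c i τ ρ (blockEquiv h i (.inl j)) = blockEquiv h c (.inl (τ j)) := by
  simp [insertPerm]

@[simp]
theorem insertPerm_inr (h : p + q = N) (c i : Fin (p + 1)) (τ : Equiv.Perm (Fin p))
    (ρ : Equiv.Perm (Fin (q + 1))) (s : Fin (q + 1)) :
    insertPerm h c i τ ρ (blockEquiv h i (.inr s)) = blockEquiv h c (.inr (ρ s)) := by
  simp [insertPerm]

/-- Equivariance of partial composition: permuting the outer slots and the inner arguments amounts
to one permutation of all arguments, which changes the insertion slot from `c` to `i`. -/
theorem insertArgs_comp_extPerm {V : Type*} (h : p + q = N) (c i : Fin (p + 1))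
    (τ : Equiv.Perm (Fin p)) (ρ : Equiv.Perm (Fin (q + 1)))
    (g : (Fin (q + 1) → V) → V) (a : Fin (N + 1) → V) :
    (fun j => insertArgs h c (fun b => g (fun s => b (ρ s))) a (extPerm c i τ j)) =
      insertArgs h i g (fun t => a (insertPerm h c i τ ρ t)) := by
  funext j
  obtain rfl | ⟨j, rfl⟩ := Fin.eq_self_or_eq_succAbove i j
  · simp [insertArgs_self]
  · simp [insertArgs_succAbove]

/-! ### Shuffles as coset representatives. -/

/-- `s` is increasing outside the block at `c`, and on the block without its last element. -/
def IsBlockShuffle (h : p + q = N) (c : Fin (p + 1)) (s : Equiv.Perm (Fin (N + 1))) : Prop :=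
  Monotone (fun j => s (blockEquiv h c (.inl j))) ∧
    Monotone (fun j => s (blockEquiv h c (.inr ((Fin.last q).succAbove j))))

/-- The permutations `insertPerm` rearrange the two sets on which a block shuffle must increase, so
each σ has exactly one factorization: a family of values has one increasing arrangement, and
injectivity of σ makes the sorting permutation unique. -/
theorem blockShuffle_bijective (h : p + q = N) (c i : Fin (p + 1)) (t : Fin (q + 1)) :
    Function.Bijective
      fun x : {s // IsBlockShuffle h c s} × Equiv.Perm (Fin p) × Equiv.Perm (Fin q) =>
        x.1.1 * insertPerm h c i x.2.1 (extPerm (Fin.last q) t x.2.2) := by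
  -- On each of the two sets, `s` is the restriction of `σ` reordered by the inverse of `τ` or `ρ`;
  -- monotonicity of `s` thus says that this inverse sorts `σ`.
  have key : ∀ (σ s : Equiv.Perm (Fin (N + 1))) (τ : Equiv.Perm (Fin p))
      (ρ : Equiv.Perm (Fin q)), s * insertPerm h c i τ (extPerm (Fin.last q) t ρ) = σ →
      (fun j => s (blockEquiv h c (.inl j))) =
        (fun j => σ (blockEquiv h i (.inl j))) ∘ τ.symm ∧
      (fun j => s (blockEquiv h c (.inr ((Fin.last q).succAbove j)))) =
        (fun j => σ (blockEquiv h i (.inr (t.succAbove j)))) ∘ ρ.symm := by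
    rintro σ s τ ρ rfl
    constructor <;> funext j <;> simp [-Fin.succAbove_last]
  constructor
  · rintro ⟨⟨s, hs₁, hs₂⟩, τ, ρ⟩ ⟨⟨s', hs₁', hs₂'⟩, τ', ρ'⟩ hh
    simp only at hh
    obtain ⟨k₁, k₂⟩ := key _ s τ ρ hh
    obtain ⟨k₁', k₂'⟩ := key _ s' τ' ρ' rfl
    rw [k₁] at hs₁
    rw [k₂] at hs₂
    rw [k₁'] at hs₁'
    rw [k₂'] at hs₂'
    have e₁ : τ = τ' := by
      have := Tuple.unique_monotone hs₁ hs₁'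
      rw [← Equiv.symm_bijective.injective.eq_iff]
      refine Equiv.ext fun j => ?_
      have := congrFun this j
      simpa [-Equiv.Perm.coe_mul] using this
    have e₂ : ρ = ρ' := by
      have := Tuple.unique_monotone hs₂ hs₂'
      rw [← Equiv.symm_bijective.injective.eq_iff]
      refine Equiv.ext fun j => ?_
      have := congrFun this j
      simpa [-Equiv.Perm.coe_mul] using this
    subst e₁ e₂
    have e₃ : s = s' := mul_right_cancel hh
    subst e₃
    rfl
  · intro σ
    -- Once `τ` and `ρ` are the inverses of the sorting permutations, `s` is forced by division.
    set τ := (Tuple.sort (fun j => σ (blockEquiv h i (.inl j)))).symm with hτ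
    set ρ := (Tuple.sort (fun j => σ (blockEquiv h i (.inr (t.succAbove j))))).symm with hρ
    have hh : (σ * (insertPerm h c i τ (extPerm (Fin.last q) t ρ))⁻¹) *
        insertPerm h c i τ (extPerm (Fin.last q) t ρ) = σ := inv_mul_cancel_right _ _
    obtain ⟨k₁, k₂⟩ := key σ _ τ ρ hh
    refine ⟨⟨⟨_, ?_, ?_⟩, τ, ρ⟩, hh⟩
    · rw [k₁]
      exact Tuple.monotone_sort _
    · rw [k₂]
      exact Tuple.monotone_sort _

open Classical in
theorem sum_blockShuffle {M : Type*} [AddCommMonoid M] (h : p + q = N) (c : Fin (p + 1))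
    (G : Fin (p + 1) → Fin (q + 1) → Equiv.Perm (Fin (N + 1)) → M) :
    ∑ s : Equiv.Perm (Fin (N + 1)) with IsBlockShuffle h c s,
      ∑ i, ∑ τ, ∑ t, ∑ ρ, G i t (s * insertPerm h c i τ (extPerm (Fin.last q) t ρ)) =
    ∑ i, ∑ t, ∑ σ, G i t σ := by
  rw [Finset.sum_comm]
  refine Finset.sum_congr rfl fun i _ => ?_
  simp_rw [Finset.sum_comm (s := (Finset.univ : Finset (Equiv.Perm (Fin p))))
    (t := (Finset.univ : Finset (Fin (q + 1))))]
  rw [Finset.sum_comm]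
  refine Finset.sum_congr rfl fun t _ => ?_
  rw [← (blockShuffle_bijective h c i t).sum_comp (G i t), Fintype.sum_prod_type]
  simp_rw [Fintype.sum_prod_type]
  rw [← Finset.sum_subtype_eq_sum_filter, Finset.subtype_univ]

/-- With the block in the last slot, the last element of the block is the position `N` itself, so
the two increasing runs are exactly those of a shuffle. Strictness is injectivity. -/
theorem isShuffle_iff (h : p + q = N) (σ : Equiv.Perm (Fin (N + 1))) :
    IsShuffle p σ ↔ IsBlockShuffle h (Fin.last p) σ ∧ σ (Fin.last N) = Fin.last N := by
  have h₁ : ∀ j : Fin p, blockEquiv h (Fin.last p) (.inl j) = ⟨j, by omega⟩ := fun j => by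
    ext
    simp [blockEquiv_inl_val]
  have h₂ : ∀ j : Fin q, blockEquiv h (Fin.last p) (.inr ((Fin.last q).succAbove j)) =
      ⟨p + j, by omega⟩ := fun j => by
    ext
    simp [blockEquiv_inr_val]
  simp only [IsShuffle, IsBlockShuffle, h₁, h₂, monotone_iff_forall_lt]
  constructor
  · rintro ⟨h₀, hs⟩
    refine ⟨⟨fun i j hij => (hs _ _ ?_ ?_).le, fun i j hij => (hs _ _ ?_ ?_).le⟩, h₀⟩ <;>
      simp only [Fin.lt_def] at * <;> omega
  · rintro ⟨⟨hs₁, hs₂⟩, h₀⟩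
    refine ⟨h₀, fun i j hij hh => lt_of_le_of_ne ?_ fun e => hij.ne (σ.injective e)⟩
    rw [Fin.lt_def] at hij
    rcases hh with hh | ⟨hh, hh'⟩
    · exact hs₁ (a := ⟨i, by omega⟩) (b := ⟨j, by omega⟩) hij
    · convert hs₂ (a := ⟨i - p, by omega⟩) (b := ⟨j - p, by omega⟩)
        (by rw [Fin.lt_def]; simp only; omega) using 3 <;> simp only <;> omega

/-- With the block in slot 0, its last element is position `q`, the isolated middle entry of the
shuffle type. For `p ≥ 1` the complement contains position `N`, which the shuffle condition omits;
fixing `N` makes the comparison there automatic. -/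
theorem isShuffleOne_iff (h : p + q = N) (σ : Equiv.Perm (Fin (N + 1))) :
    IsShuffleOne q σ ↔ IsBlockShuffle h 0 σ ∧ σ (Fin.last N) = Fin.last N := by
  have h₁ : ∀ j : Fin p, blockEquiv h 0 (.inl j) = ⟨j + 1 + q, by omega⟩ := fun j => by
    ext
    simp [blockEquiv_inl_val]
  have h₂ : ∀ j : Fin q, blockEquiv h 0 (.inr ((Fin.last q).succAbove j)) =
      ⟨j, by omega⟩ := fun j => by
    ext
    simp [blockEquiv_inr_val]
  simp only [IsShuffleOne, IsBlockShuffle, h₁, h₂, monotone_iff_forall_lt]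
  constructor
  · rintro ⟨h₀, hs⟩
    refine ⟨⟨fun i j hij => ?_, fun i j hij => (hs _ _ ?_ ?_).le⟩, h₀⟩
    · by_cases hj : (j : ℕ) + 1 + q = N
      · have : (⟨j + 1 + q, by omega⟩ : Fin (N + 1)) = Fin.last N := Fin.ext hj
        rw [this, h₀]
        exact Fin.le_last _
      · refine (hs _ _ ?_ ?_).le <;> simp only [Fin.lt_def] at * <;> omega
    all_goals (simp only [Fin.lt_def] at *; omega)
  · rintro ⟨⟨hs₁, hs₂⟩, h₀⟩
    refine ⟨h₀, fun i j hij hh => lt_of_le_of_ne ?_ fun e => hij.ne (σ.injective e)⟩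
    rw [Fin.lt_def] at hij
    rcases hh with hh | ⟨hh, hh'⟩
    · exact hs₂ (a := ⟨i, by omega⟩) (b := ⟨j, by omega⟩) hij
    · convert hs₁ (a := ⟨i - 1 - q, by omega⟩) (b := ⟨j - 1 - q, by omega⟩)
        (by rw [Fin.lt_def]; simp only; omega) using 3 <;> simp only <;> omega

end Combinatorics

/-! ### Koszul signs of products and of block permutations. -/

section Signs

theorem negOnePow_sum {ι : Type*} (s : Finset ι) (f : ι → ℤ) :
    (∑ i ∈ s, f i).negOnePow = ∏ i ∈ s, (f i).negOnePow := by
  classical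
  induction s using Finset.induction_on with
  | empty => simp
  | insert a s ha ih => rw [Finset.sum_insert ha, Finset.prod_insert ha, Int.negOnePow_add, ih]

/-- Lets sign products be compared by unordered pairs: reindexing by a permutation can move a factor
from `(i, j)` to `(j, i)`. -/
theorem prod_prod_congr_of_symm {M ι : Type*} [CommMonoid M] [Fintype ι] [LinearOrder ι]
    {F G : ι → ι → M} (h₀ : ∀ i, F i i = G i i)
    (h : ∀ i j, i < j → F i j * F j i = G i j * G j i) :
    ∏ i, ∏ j, F i j = ∏ i, ∏ j, G i j := by
  have key : ∀ F : ι → ι → M, ∏ i, ∏ j, F i j =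
      (∏ i, ∏ j, if i < j then F i j * F j i else 1) * ∏ i, F i i := by
    intro F
    have e₁ : ∏ i, ∏ j, F i j = (∏ i, ∏ j, if i < j then F i j else 1) *
        ((∏ i, ∏ j, if j < i then F i j else 1) * ∏ i, ∏ j, if i = j then F i j else 1) := by
      simp_rw [← Finset.prod_mul_distrib]
      refine Finset.prod_congr rfl fun i _ => Finset.prod_congr rfl fun j _ => ?_
      rcases lt_trichotomy i j with hij | hij | hij
      · simp [hij, hij.not_gt, hij.ne]
      · simp [hij]
      · simp [hij, hij.not_gt, hij.ne']
    rw [e₁, Finset.prod_comm (f := fun i j => if j < i then F i j else 1), ← mul_assoc]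
    congr 1
    · simp_rw [← Finset.prod_mul_distrib]
      refine Finset.prod_congr rfl fun i _ => Finset.prod_congr rfl fun j _ => ?_
      split_ifs <;> simp
    · simp
  rw [key F, key G]
  congr 1
  · refine Finset.prod_congr rfl fun i _ => Finset.prod_congr rfl fun j _ => ?_
    split_ifs with hij
    · exact h i j hij
    · rfl
  · exact Finset.prod_congr rfl fun i _ => h₀ i

theorem koszulSign_eq_prod {ι : Type*} [Fintype ι] {k : ℕ} (e : ι ≃ Fin k)
    (σ : Equiv.Perm (Fin k)) (d : Fin k → ℤ) :
    koszulSign σ d = ∏ x, ∏ y, if e x < e y ∧ σ (e y) < σ (e x) then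
      Int.negOnePow (d (σ (e x)) * d (σ (e y))) else 1 := by
  rw [koszulSign, ← e.prod_comp]
  exact Finset.prod_congr rfl fun x _ => (e.prod_comp _).symm

/-- A pair inverted by `τ` and then inverted back by `σ` contributes the same sign twice, hence
nothing; all other pairs match directly. -/
theorem koszulSign_mul {k : ℕ} (σ τ : Equiv.Perm (Fin k)) (d : Fin k → ℤ) :
    koszulSign (σ * τ) d = koszulSign σ d * koszulSign τ (fun i => d (σ i)) := by
  rw [koszulSign_eq_prod τ σ d, koszulSign, koszulSign]
  simp_rw [← Finset.prod_mul_distrib]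
  refine prod_prod_congr_of_symm (fun i => by simp) fun i j hij => ?_
  have hτ : τ i ≠ τ j := fun e => hij.ne (τ.injective e)
  have hσ : σ (τ i) ≠ σ (τ j) := fun e => hτ (σ.injective e)
  simp only [Equiv.Perm.mul_apply, hij, hij.not_gt, true_and, false_and, if_false, mul_one,
    mul_comm (d (σ (τ j)))]
  rcases lt_or_gt_of_ne hτ with h₁ | h₁ <;> rcases lt_or_gt_of_ne hσ with h₂ | h₂ <;>
    simp [h₁, h₂, h₁.not_gt, h₂.not_gt]

/-- Rewrites the prefix sign as one factor per position outside the block, the form in which it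
meets the Koszul factors. -/
theorem negOnePow_mul_sum_filter_lt {p q N : ℕ} (h : p + q = N) (n : ℤ) (c : Fin (p + 1))
    (d : Fin (N + 1) → ℤ) :
    Int.negOnePow (n * ∑ s ∈ Finset.univ.filter (fun s : Fin (N + 1) => (s : ℕ) < c), d s) =
      ∏ j : Fin p, if c.succAbove j < c then
        Int.negOnePow (d (blockEquiv h c (.inl j)) * n) else 1 := by
  rw [Finset.mul_sum, negOnePow_sum, Finset.prod_filter, ← (blockEquiv h c).prod_comp,
    Fintype.prod_sum_type]
  rw [Finset.prod_eq_one (s := (Finset.univ : Finset (Fin (q + 1))))]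
  · rw [mul_one]
    refine Finset.prod_congr rfl fun j _ => ?_
    have : (blockEquiv h c (.inl j) : ℕ) < c ↔ c.succAbove j < c := by
      rw [← blockEquiv_inl_lt_inr h c j 0, Fin.lt_def, blockEquiv_inr_val, Fin.val_zero, add_zero]
    simp only [this, mul_comm n]
  · intro s _
    rw [blockEquiv_inr_val, if_neg (by omega)]

/-- Pairs outside the block give the same factors on both sides, and pairs inside it give the sign
of `ρ`. An outer argument that crosses the block sees the total degree of the block plus `n` on the
left but only the total degree on the right; the surplus `n` is the change in the prefix sign when
the block moves from `c` to `i`. -/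
theorem koszulSign_insertPerm {p q N : ℕ} (h : p + q = N) (n : ℤ) (c i : Fin (p + 1))
    (τ : Equiv.Perm (Fin p)) (ρ : Equiv.Perm (Fin (q + 1))) (d : Fin (N + 1) → ℤ) :
    koszulSign (extPerm c i τ) (insertArgs h c (fun b => (∑ s, b s) + n) d) *
        koszulSign ρ (fun s => d (blockEquiv h c (.inr s))) *
        Int.negOnePow (n * ∑ s ∈ Finset.univ.filter (fun s : Fin (N + 1) => (s : ℕ) < c), d s) =
      koszulSign (insertPerm h c i τ ρ) d *
        Int.negOnePow (n * ∑ s ∈ Finset.univ.filter (fun s : Fin (N + 1) => (s : ℕ) < i), d (insertPerm h c i τ ρ s)) := by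
  rw [negOnePow_mul_sum_filter_lt h n c, negOnePow_mul_sum_filter_lt h n i
    (fun s => d (insertPerm h c i τ ρ s)), koszulSign_eq_prod (blockEquiv h i) (insertPerm h c i τ ρ),
    ← Equiv.prod_comp τ (fun j => if c.succAbove j < c then
        Int.negOnePow (d (blockEquiv h c (.inl j)) * n) else 1)]
  simp only [koszulSign, Fintype.prod_sum_type, Fin.prod_univ_succAbove _ i, extPerm_self,
    extPerm_succAbove, insertArgs_self, insertArgs_succAbove, insertPerm_inl, insertPerm_inr,
    blockEquiv_inl_lt_inl, blockEquiv_inl_lt_inr, blockEquiv_inr_lt_inl, blockEquiv_inr_lt_inr,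
    Finset.prod_mul_distrib, lt_irrefl, false_and, if_false, one_mul,
    Fin.succAbove_lt_succAbove_iff]
  -- The factors of one outer argument against all block entries combine into its factor against the
  -- total degree of the block, which `ρ` does not change.
  have e₁ : ∀ (P Q : Fin p → Prop) [∀ j, Decidable (P j ∧ Q j)],
      (∏ j : Fin p, ∏ s : Fin (q + 1), if P j ∧ Q j then
        Int.negOnePow (d (blockEquiv h c (.inl (τ j))) * d (blockEquiv h c (.inr (ρ s)))) else 1) =
      ∏ j : Fin p, if P j ∧ Q j then
        Int.negOnePow (d (blockEquiv h c (.inl (τ j))) *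
          ∑ s, d (blockEquiv h c (.inr s))) else 1 := by
    intro P Q _
    refine Finset.prod_congr rfl fun j _ => ?_
    split_ifs
    · rw [Finset.mul_sum, negOnePow_sum]
      exact Equiv.prod_comp ρ fun s => Int.negOnePow
        (d (blockEquiv h c (.inl (τ j))) * d (blockEquiv h c (.inr s)))
    · simp
  have e₂ : ∀ F : Fin (q + 1) → Fin p → ℤˣ, ∏ s, ∏ j, F s j = ∏ j, ∏ s, F s j :=
    fun F => Finset.prod_comm
  simp only [mul_comm (d (blockEquiv h c (.inr _))) (d (blockEquiv h c (.inl _))),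
    mul_comm (_ + n) (d (blockEquiv h c (.inl _))), e₂, e₁, mul_add, Int.negOnePow_add]
  -- `T` (both outside) and `R` (both inside) cancel. What remains are the mixed pairs and the
  -- prefix signs, compared for each outer argument according to its side of the block before and
  -- after.
  have aux : ∀ {A B T R C A' B' C' : ℤˣ}, A * B * C = A' * B' * C' →
      A * (B * T) * R * C = T * A' * (B' * R) * C' := by
    intro A B T R C A' B' C' hh
    calc A * (B * T) * R * C = A * B * C * (T * R) := by ac_rfl
      _ = T * A' * (B' * R) * C' := by rw [hh]; ac_rfl
  refine aux ?_
  simp_rw [← Finset.prod_mul_distrib]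
  refine Finset.prod_congr rfl fun j _ => ?_
  have h₁ : i.succAbove j ≠ i := Fin.succAbove_ne i j
  have h₂ : c.succAbove (τ j) ≠ c := Fin.succAbove_ne c (τ j)
  rcases lt_or_gt_of_ne h₁ with h₁ | h₁ <;> rcases lt_or_gt_of_ne h₂ with h₂ | h₂ <;>
    simp [h₁, h₂, h₁.not_gt, h₂.not_gt, mul_assoc]

end Signs

/-! ### Linearity and degrees of insertions. -/

section MultilinearInsertion

variable {K V : Type*} [Field K] [AddCommGroup V] [Module K V] {p q N : ℕ}

theorem insertArgs_eq_update (h : p + q = N) (i : Fin (p + 1))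
    (g : (Fin (q + 1) → V) → V) (a : Fin (N + 1) → V) :
    insertArgs h i g a = Function.update (insertArgs h i (fun _ => 0) a) i
      (g fun s => a (blockEquiv h i (.inr s))) := by
  funext j
  obtain rfl | ⟨j, rfl⟩ := Fin.eq_self_or_eq_succAbove i j
  · simp [insertArgs_self]
  · rw [Function.update_of_ne (Fin.succAbove_ne i j), insertArgs_succAbove, insertArgs_succAbove]

theorem map_update_units_smul {k : ℕ} (f : MultilinearMap K (fun _ : Fin k => V) V)
    (a : Fin k → V) (i : Fin k) (u : ℤˣ) (x : V) :
    f (Function.update a i (u • x)) = u • f (Function.update a i x) := by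
  rcases Int.units_eq_one_or u with rfl | rfl
  · simp
  · rw [Units.neg_smul, Units.neg_smul, one_smul, one_smul, f.map_update_neg]

/-- The expansion of `g` is required only at the arguments in question, because the Koszul sum for a
symmetrization is available only on homogeneous arguments of fixed degrees. -/
theorem map_insertArgs_sum {ι : Type*} (h : p + q = N) (i : Fin (p + 1))
    (f : MultilinearMap K (fun _ : Fin (p + 1) => V) V) (S : Finset ι) (u : ι → ℤˣ)
    (g : (Fin (q + 1) → V) → V) (g' : ι → (Fin (q + 1) → V) → V) (a : Fin (N + 1) → V)
    (hg : g (fun s => a (blockEquiv h i (.inr s))) =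
      ∑ k ∈ S, u k • g' k (fun s => a (blockEquiv h i (.inr s)))) :
    f (insertArgs h i g a) = ∑ k ∈ S, u k • f (insertArgs h i (g' k) a) := by
  rw [insertArgs_eq_update, hg, f.map_update_sum]
  refine Finset.sum_congr rfl fun k _ => ?_
  rw [map_update_units_smul, ← insertArgs_eq_update]

theorem units_smul_mem (W : Submodule K V) (u : ℤˣ) {x : V} (hx : x ∈ W) : u • x ∈ W := by
  rcases Int.units_eq_one_or u with rfl | rfl
  · simpa using hx
  · rw [Units.neg_smul, one_smul]
    exact W.neg_mem hx

theorem insertArgs_mem (𝒱 : ℤ → Submodule K V) (h : p + q = N) (c : Fin (p + 1)) {n : ℤ}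
    {g : MultilinearMap K (fun _ : Fin (q + 1) => V) V} (hg : IsHomogeneousOfDegree 𝒱 n g)
    {d : Fin (N + 1) → ℤ} {a : Fin (N + 1) → V} (ha : ∀ i, a i ∈ 𝒱 (d i)) (j : Fin (p + 1)) :
    insertArgs h c g a j ∈ 𝒱 (insertArgs h c (fun b => (∑ s, b s) + n) d j) := by
  obtain rfl | ⟨j, rfl⟩ := Fin.eq_self_or_eq_succAbove c j
  · rw [insertArgs_self, insertArgs_self]
    exact hg _ _ fun s => ha _
  · rw [insertArgs_succAbove, insertArgs_succAbove]
    exact ha _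

end MultilinearInsertion

/-! ### Symmetrization intertwines the two products. -/

section Symmetrization

variable {K V : Type*} [Field K] [AddCommGroup V] [Module K V]
variable (𝒱 : ℤ → Submodule K V) [DirectSum.Decomposition 𝒱]

theorem symmetrization_apply (μ : DendFamily K V) (k : ℕ) (d : Fin (k + 1) → ℤ)
    (a : Fin (k + 1) → V) (ha : ∀ i, a i ∈ 𝒱 (d i)) :
    symmetrization 𝒱 μ k a = ∑ σ : Equiv.Perm (Fin (k + 1)),
      koszulSign σ d • μ k (σ.symm (Fin.last k)) (fun i => a (σ i)) := by
  change ofHomogeneous 𝒱 _ a = _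
  rw [ofHomogeneous_apply 𝒱 _ d a ha]
  simp [sum_apply, smul_apply]

theorem symmetrization_mem {n : ℤ} {μ : DendFamily K V} (hμ : μ ∈ DendHom 𝒱 n) :
    symmetrization 𝒱 μ ∈ PreLieHom 𝒱 n := by
  intro k
  refine ⟨fun d a ha => ?_, fun d a ha τ hτ => ?_⟩
  · rw [symmetrization_apply 𝒱 μ k d a ha]
    refine Submodule.sum_mem _ fun σ _ => units_smul_mem _ _ ?_
    rw [← Equiv.sum_comp σ d]
    exact hμ k _ _ _ fun i => ha (σ i)
  -- Substitute τσ for σ in the sum: since τ fixes the last index, the colour σ⁻¹(last) is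
  -- unchanged, and the sign of τ appears squared.
  · rw [symmetrization_apply 𝒱 μ k _ _ fun i => ha (τ i), symmetrization_apply 𝒱 μ k d a ha,
      Finset.smul_sum, ← Equiv.sum_comp (Equiv.mulLeft τ) fun σ => koszulSign τ d •
        koszulSign σ d • μ k (σ.symm (Fin.last k)) (fun i => a (σ i))]
    refine Finset.sum_congr rfl fun σ _ => ?_
    have h₁ : (τ * σ).symm (Fin.last k) = σ.symm (Fin.last k) := by
      rw [Equiv.symm_apply_eq, Equiv.Perm.mul_apply, Equiv.apply_symm_apply, hτ]
    rw [Equiv.coe_mulLeft, h₁, koszulSign_mul, smul_smul, ← mul_assoc, Int.units_mul_self, one_mul]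
    rfl

variable {p q N : ℕ}

/-- The summand of the symmetrization of an insertion, for the order `σ` of the arguments. -/
def insertTerm (h : p + q = N) (n : ℤ) (μ η : DendFamily K V) (d : Fin (N + 1) → ℤ)
    (a : Fin (N + 1) → V) (i : Fin (p + 1)) (t : Fin (q + 1)) (σ : Equiv.Perm (Fin (N + 1))) : V :=
  (koszulSign σ d * Int.negOnePow
      (n * ∑ s ∈ Finset.univ.filter (fun s : Fin (N + 1) => (s : ℕ) < i), d (σ s))) •
    μ p (R₀ h i (σ.symm (Fin.last N))) (insertArgs h i (η q t) (fun s => a (σ s)))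

theorem R₀_last (h : p + q = N) (c : Fin (p + 1)) : R₀ h c (Fin.last N) = Fin.last p := by
  simp only [R₀, Fin.val_last]
  split_ifs <;> rw [Fin.ext_iff] <;> simp only [Fin.val_last] <;> omega

/-- `R₀` collapses the block to one slot, and block permutations descend to this collapse. With
`R₀_last` it identifies the outer colour in `insertTerm` with the one prescribed by Ψ(μ). -/
theorem R₀_insertPerm_symm (h : p + q = N) (c i : Fin (p + 1)) (τ : Equiv.Perm (Fin p))
    (ρ : Equiv.Perm (Fin (q + 1))) (x : Fin (N + 1)) :
    R₀ h i ((insertPerm h c i τ ρ).symm x) = (extPerm c i τ).symm (R₀ h c x) := by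
  obtain ⟨y, rfl⟩ := (insertPerm h c i τ ρ).surjective x
  obtain ⟨j | s, rfl⟩ := (blockEquiv h i).surjective y
  · rw [Equiv.symm_apply_apply, insertPerm_inl, R₀_inl, R₀_inl, extPerm_symm_succAbove,
      Equiv.symm_apply_apply]
  · rw [Equiv.symm_apply_apply, insertPerm_inr, R₀_inr, R₀_inr, extPerm_symm_self]

/-- Both symmetrizations are expanded for one fixed `s`. The outer permutation is parametrized by
the preimage `i` of the slot `c`, the inner one by the preimage `t` of its last index, which is the
colour of `η`. -/
theorem insert_symmetrization_eq_sum (h : p + q = N) {n : ℤ} (μ : DendFamily K V)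
    {η : DendFamily K V} (hη : η ∈ DendHom 𝒱 n) {d : Fin (N + 1) → ℤ} {a : Fin (N + 1) → V}
    (ha : ∀ i, a i ∈ 𝒱 (d i)) (c : Fin (p + 1)) (s : Equiv.Perm (Fin (N + 1)))
    (hs : s (Fin.last N) = Fin.last N) :
    (koszulSign s d * Int.negOnePow
      (n * ∑ r ∈ Finset.univ.filter (fun r : Fin (N + 1) => (r : ℕ) < c), d (s r))) •
      insertAt h c (symmetrization 𝒱 μ p) (symmetrization 𝒱 η q) (fun r => a (s r)) =
    ∑ i, ∑ τ, ∑ t, ∑ ρ, insertTerm h n μ η d a i t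
      (s * insertPerm h c i τ (extPerm (Fin.last q) t ρ)) := by
  change _ • symmetrization 𝒱 μ p (insertArgs h c (symmetrization 𝒱 η q) fun r => a (s r)) = _
  rw [symmetrization_apply 𝒱 μ p _ _ (insertArgs_mem 𝒱 h c (symmetrization_mem 𝒱 hη q).1
    (d := fun r => d (s r)) fun r => ha (s r)), sum_perm_eq_sum_extPerm c, Finset.smul_sum]
  refine Finset.sum_congr rfl fun i _ => ?_
  rw [Finset.smul_sum]
  refine Finset.sum_congr rfl fun τ _ => ?_
  have e₁ : ∑ t, ∑ ρ, insertTerm h n μ η d a i t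
        (s * insertPerm h c i τ (extPerm (Fin.last q) t ρ)) =
      ∑ ρ : Equiv.Perm (Fin (q + 1)), insertTerm h n μ η d a i (ρ.symm (Fin.last q))
        (s * insertPerm h c i τ ρ) := by
    rw [sum_perm_eq_sum_extPerm (Fin.last q)]
    simp only [extPerm_symm_self]
  -- The inner permutation is taken to be 1 until the inner symmetrization is expanded; `e₃` then
  -- absorbs `ρ` into the block permutation.
  have e₂ : (fun j => insertArgs h c (symmetrization 𝒱 η q) (fun r => a (s r))
      (extPerm c i τ j)) = insertArgs h i (symmetrization 𝒱 η q)
        (fun r => a (s (insertPerm h c i τ 1 r))) :=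
    insertArgs_comp_extPerm h c i τ 1 (symmetrization 𝒱 η q) fun r => a (s r)
  rw [e₁, e₂, map_insertArgs_sum h i _ Finset.univ
      (fun ρ => koszulSign ρ fun u => d (s (blockEquiv h c (.inr u)))) _
      (fun ρ b => η q (ρ.symm (Fin.last q)) fun u => b (ρ u)), smul_smul, Finset.smul_sum]
  · refine Finset.sum_congr rfl fun ρ _ => ?_
    have e₃ : insertArgs h i (fun b => η q (ρ.symm (Fin.last q)) fun u => b (ρ u))
        (fun r => a (s (insertPerm h c i τ 1 r))) =
        insertArgs h i (η q (ρ.symm (Fin.last q))) (fun r => a (s (insertPerm h c i τ ρ r))) :=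
      (insertArgs_comp_extPerm h c i τ 1 (fun b => η q (ρ.symm (Fin.last q)) fun u => b (ρ u))
        (fun r => a (s r))).symm.trans (insertArgs_comp_extPerm h c i τ ρ _ _)
    have h₁ : (s * insertPerm h c i τ ρ).symm (Fin.last N) =
        (insertPerm h c i τ ρ).symm (Fin.last N) := by
      rw [Equiv.symm_apply_eq, Equiv.Perm.mul_apply, Equiv.apply_symm_apply, hs]
    have h₂ := koszulSign_insertPerm h n c i τ ρ fun r => d (s r)
    rw [insertTerm, h₁, R₀_insertPerm_symm, R₀_last, smul_smul, koszulSign_mul, e₃]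
    congr 1
    simp only [Equiv.Perm.mul_apply]
    rw [mul_assoc (koszulSign s d) _ (Int.negOnePow _), ← h₂]
    ac_rfl
  · rw [symmetrization_apply 𝒱 η q (fun u => d (s (blockEquiv h c (.inr u)))) _ fun u => by
      simpa using ha _]

/-- If the final position lies outside the block, monotonicity there makes its value the largest
outside the block, so the maximum `N` can be taken outside only at that position. -/
theorem isBlockShuffle_last_exists_inl_iff (h : p + q = N) {c : Fin (p + 1)}
    (hc : ∃ j, blockEquiv h c (.inl j) = Fin.last N) {s : Equiv.Perm (Fin (N + 1))}
    (hs : IsBlockShuffle h c s) :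
    (∃ j, s (blockEquiv h c (.inl j)) = Fin.last N) ↔ s (Fin.last N) = Fin.last N := by
  obtain ⟨l, hl⟩ := hc
  refine ⟨fun ⟨j, hj⟩ => ?_, fun h₀ => ⟨l, hl ▸ h₀⟩⟩
  have : j ≤ l := by
    rw [← not_lt, ← blockEquiv_inl_lt_inl h c, hl]
    exact (Fin.le_last _).not_gt
  have := hs.1 this
  simp only [hj, hl] at this
  exact le_antisymm (Fin.le_last _) this

-- The last argument enters η. The indicator reduces to `s` fixing the last index, because `t` is
-- sent to the end of the block in the last slot, which is position `N`.
open Classical in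
theorem sum_isShuffle (h : p + q = N) {n : ℤ} (μ : DendFamily K V)
    {η : DendFamily K V} (hη : η ∈ DendHom 𝒱 n) {d : Fin (N + 1) → ℤ} {a : Fin (N + 1) → V}
    (ha : ∀ i, a i ∈ 𝒱 (d i)) :
    ∑ s : Equiv.Perm (Fin (N + 1)) with IsShuffle p s,
      (koszulSign s d * Int.negOnePow
        (n * ∑ r ∈ Finset.univ.filter (fun r : Fin (N + 1) => (r : ℕ) < p), d (s r))) •
      insertAt h (Fin.last p) (symmetrization 𝒱 μ p) (symmetrization 𝒱 η q) (fun r => a (s r)) =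
    ∑ i, ∑ t, ∑ σ : Equiv.Perm (Fin (N + 1)),
      if σ (blockEquiv h i (.inr t)) = Fin.last N then insertTerm h n μ η d a i t σ else 0 := by
  rw [← sum_blockShuffle h (Fin.last p) fun i t (σ : Equiv.Perm (Fin (N + 1))) =>
    if σ (blockEquiv h i (.inr t)) = Fin.last N then insertTerm h n μ η d a i t σ else 0]
  simp_rw [isShuffle_iff h]
  rw [← Finset.filter_filter, Finset.sum_filter (fun s : Equiv.Perm (Fin (N + 1)) =>
    s (Fin.last N) = Fin.last N)]
  refine Finset.sum_congr rfl fun s _ => ?_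
  have h₀ : blockEquiv h (Fin.last p) (.inr (Fin.last q)) = Fin.last N := by
    ext
    simpa [blockEquiv_inr_val] using h
  simp only [Equiv.Perm.mul_apply, insertPerm_inr, extPerm_self, h₀]
  split_ifs with hs
  · exact insert_symmetrization_eq_sum 𝒱 h μ hη ha (Fin.last p) s hs
  · simp

-- The last argument stays outside η, so no single `t` is selected. For slot 0 the prefix sign is
-- trivial.
open Classical in
theorem sum_isShuffleOne (h : p + q = N) {n : ℤ} (μ : DendFamily K V)
    {η : DendFamily K V} (hη : η ∈ DendHom 𝒱 n) {d : Fin (N + 1) → ℤ} {a : Fin (N + 1) → V}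
    (ha : ∀ i, a i ∈ 𝒱 (d i)) :
    (if 1 ≤ p then ∑ s : Equiv.Perm (Fin (N + 1)) with IsShuffleOne q s,
      koszulSign s d •
      insertAt h 0 (symmetrization 𝒱 μ p) (symmetrization 𝒱 η q) (fun r => a (s r)) else 0) =
    ∑ i, ∑ t, ∑ σ : Equiv.Perm (Fin (N + 1)),
      if ∃ j, σ (blockEquiv h i (.inl j)) = Fin.last N then
        insertTerm h n μ η d a i t σ else 0 := by
  split_ifs with hp
  · rw [← sum_blockShuffle h 0 fun i t (σ : Equiv.Perm (Fin (N + 1))) =>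
      if ∃ j, σ (blockEquiv h i (.inl j)) = Fin.last N then insertTerm h n μ η d a i t σ else 0]
    simp_rw [isShuffleOne_iff h]
    rw [← Finset.filter_filter, Finset.sum_filter (fun s : Equiv.Perm (Fin (N + 1)) =>
      s (Fin.last N) = Fin.last N)]
    refine Finset.sum_congr rfl fun s hs => ?_
    have h₀ : ∃ j, blockEquiv h 0 (.inl j) = Fin.last N :=
      ⟨⟨p - 1, by omega⟩, by ext; simp [blockEquiv_inl_val]; omega⟩
    have h₁ : ∀ τ : Equiv.Perm (Fin p), (∃ j, s (blockEquiv h 0 (.inl (τ j))) = Fin.last N) ↔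
        s (Fin.last N) = Fin.last N := fun τ => by
      rw [← isBlockShuffle_last_exists_inl_iff h h₀ (Finset.mem_filter.1 hs).2]
      exact (τ.surjective.exists (p := fun j => s (blockEquiv h 0 (.inl j)) = Fin.last N)).symm
    simp only [Equiv.Perm.mul_apply, insertPerm_inl, h₁]
    split_ifs with hs'
    · simpa using insert_symmetrization_eq_sum 𝒱 h μ hη ha 0 s hs'
    · simp
  -- With `p = 0` nothing lies outside the block, so the right side vanishes like the missing term
  -- on the left.
  · obtain rfl : p = 0 := by omega
    simp

theorem symmetrization_dendComp {n : ℤ} (μ : DendFamily K V) {η : DendFamily K V}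
    (hη : η ∈ DendHom 𝒱 n) :
    symmetrization 𝒱 (dendComp 𝒱 n μ η) =
      mnComp 𝒱 n (symmetrization 𝒱 μ) (symmetrization 𝒱 η) := by
  classical
  funext N
  refine ext_homogeneous 𝒱 fun d a ha => ?_
  have e₁ : ∀ σ : Equiv.Perm (Fin (N + 1)),
      dendComp 𝒱 n μ η N (σ.symm (Fin.last N)) (fun i => a (σ i)) = _ :=
    fun σ => ofHomogeneous_apply 𝒱 _ (fun i => d (σ i)) _ fun i => ha (σ i)
  have e₂ : mnComp 𝒱 n (symmetrization 𝒱 μ) (symmetrization 𝒱 η) N a = _ :=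
    ofHomogeneous_apply 𝒱 _ d a ha
  rw [symmetrization_apply 𝒱 _ N d a ha, e₂]
  simp only [e₁, sum_apply, smul_apply, Finset.smul_sum]
  rw [Finset.sum_comm]
  refine Finset.sum_congr rfl fun ⟨⟨p, q⟩, hx⟩ _ => ?_
  have h : p + q = N := Finset.HasAntidiagonal.mem_antidiagonal.mp hx
  have e₃ := sum_isShuffle 𝒱 h μ hη ha
  have e₄ := sum_isShuffleOne 𝒱 h μ hη ha
  -- Separates the terms by whether σ⁻¹(last) lies outside or inside the block; `Rᵢ` is all colours
  -- in the first case and a singleton in the second.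
  trans (∑ i, ∑ t, ∑ σ : Equiv.Perm (Fin (N + 1)),
      if ∃ j, σ (blockEquiv h i (.inl j)) = Fin.last N then
        insertTerm h n μ η d a i t σ else 0) + ∑ i, ∑ t, ∑ σ : Equiv.Perm (Fin (N + 1)),
      if σ (blockEquiv h i (.inr t)) = Fin.last N then insertTerm h n μ η d a i t σ else 0
  · rw [Finset.sum_comm, ← Finset.sum_add_distrib]
    refine Finset.sum_congr rfl fun i _ => ?_
    rw [Finset.sum_comm (s := (Finset.univ : Finset (Fin (q + 1)))),
      Finset.sum_comm (s := (Finset.univ : Finset (Fin (q + 1)))), ← Finset.sum_add_distrib]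
    refine Finset.sum_congr rfl fun σ _ => ?_
    have e₅ : insertAt h i (μ p (R₀ h i (σ.symm (Fin.last N))))
        (∑ t ∈ Rᵢ h i (σ.symm (Fin.last N)), η q t) (fun r => a (σ r)) =
        ∑ t ∈ Rᵢ h i (σ.symm (Fin.last N)), (1 : ℤˣ) • μ p (R₀ h i (σ.symm (Fin.last N)))
          (insertArgs h i (η q t) fun r => a (σ r)) :=
      map_insertArgs_sum h i _ _ (fun _ => 1) _ (fun t => η q t) _ (by simp [sum_apply])
    change koszulSign σ d • _ • insertAt h i (μ p (R₀ h i (σ.symm (Fin.last N))))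
        (∑ t ∈ Rᵢ h i (σ.symm (Fin.last N)), η q t) (fun r => a (σ r)) = _
    rw [e₅, smul_smul, Finset.smul_sum]
    simp only [one_smul]
    change ∑ t ∈ Rᵢ h i (σ.symm (Fin.last N)), insertTerm h n μ η d a i t σ = _
    obtain ⟨j | u, hy⟩ := (blockEquiv h i).surjective (σ.symm (Fin.last N)) <;>
      rw [← hy] <;> rw [Equiv.eq_symm_apply] at hy <;>
      simp [← hy, Rᵢ_inl, Rᵢ_inr]
  · rw [← e₃, ← e₄]
    refine congrArg₂ (· + ·) ?_ ?_
    · split_ifs with hp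
      · simp only [sum_apply, smul_apply]
        rfl
      · rfl
    · simp only [sum_apply, smul_apply]
      rfl

theorem symmetrization_dendBracket {m n : ℤ} {μ η : DendFamily K V} (hμ : μ ∈ DendHom 𝒱 m)
    (hη : η ∈ DendHom 𝒱 n) :
    symmetrization 𝒱 (dendBracket 𝒱 m n μ η) =
      mnBracket 𝒱 m n (symmetrization 𝒱 μ) (symmetrization 𝒱 η) := by
  rw [dendBracket, mnBracket, map_sub, ← symmetrization_dendComp 𝒱 μ hη,
    ← symmetrization_dendComp 𝒱 η hμ, Units.smul_def, Units.smul_def, map_zsmul]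

end Symmetrization

end HomotopyDend
open HomotopyDend in
theorem mainTheorem10 {K V : Type*} [Field K] [CharZero K] [AddCommGroup V] [Module K V]
    (𝒱 : ℤ → Submodule K V) [DirectSum.Decomposition 𝒱] :
    -- every `Dend_∞[1]`-algebra gives a `pre-Lie_∞[1]`-algebra `(V, θ)`, and `θ` is the unique
    -- family of multilinear maps with the stated formula on homogeneous elements
    (∀ μ : DendFamily K V, IsDendInfty 𝒱 μ →
      ∃! θ : PreLieFamily K V, IsPreLieInfty 𝒱 θ ∧
        ∀ (k : ℕ) (d : Fin (k + 1) → ℤ) (a : Fin (k + 1) → V), (∀ i, a i ∈ 𝒱 (d i)) →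
          θ k a = ∑ σ : Equiv.Perm (Fin (k + 1)),
            koszulSign σ d • μ k (σ⁻¹ (Fin.last k)) (fun i => a (σ i))) ∧
    -- the symmetrization map is a morphism of graded Lie algebras
    ((∀ (n : ℤ) (μ : DendFamily K V), μ ∈ DendHom 𝒱 n → symmetrization 𝒱 μ ∈ PreLieHom 𝒱 n) ∧
      ∀ (m n : ℤ) (μ η : DendFamily K V), μ ∈ DendHom 𝒱 m → η ∈ DendHom 𝒱 n →
        symmetrization 𝒱 (dendBracket 𝒱 m n μ η) =
          mnBracket 𝒱 m n (symmetrization 𝒱 μ) (symmetrization 𝒱 η)) := by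
  have hmem : ∀ (n : ℤ) (μ : DendFamily K V), μ ∈ DendHom 𝒱 n →
      symmetrization 𝒱 μ ∈ PreLieHom 𝒱 n := fun n μ hμ => symmetrization_mem 𝒱 hμ
  have hbr : ∀ (m n : ℤ) (μ η : DendFamily K V), μ ∈ DendHom 𝒱 m → η ∈ DendHom 𝒱 n →
      symmetrization 𝒱 (dendBracket 𝒱 m n μ η) =
        mnBracket 𝒱 m n (symmetrization 𝒱 μ) (symmetrization 𝒱 η) :=
    fun m n μ η hμ hη => symmetrization_dendBracket 𝒱 hμ hη
  refine ⟨fun μ hμ => ⟨symmetrization 𝒱 μ, ⟨⟨hmem 1 μ hμ.1, ?_⟩, symmetrization_apply 𝒱 μ⟩, ?_⟩,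
    hmem, hbr⟩
  -- The Maurer–Cartan equation is transported: the bracket of Ψ(μ) with itself is the image of 0.
  · rw [← hbr 1 1 μ μ hμ.1 hμ.1, hμ.2, map_zero]
  · rintro θ ⟨-, hθ⟩
    funext k
    refine ext_homogeneous 𝒱 fun d a ha => ?_
    rw [hθ k d a ha, symmetrization_apply 𝒱 μ k d a ha]
    rfl
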